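/- Conventions. A decompressor is a partial computable function $D$ from binary strings to natural numbers, and $C_D(x)=\min\{|p| : D(p)=x\}$ (with $\min\emptyset=\infty$). Let $C$ be plain Kolmogorov complexity, i.e. $C=C_D$ for an optimal decompressor $D$ (for every decompressor $D'$ there is a constant $c$ with $C_D\le C_{D'}+c$), and let $K$ be prefix complexity, i.e. $K=C_P$ for an optimal $P$ among prefix-free decompressors (no element of the domain is a proper prefix of another). For an integer $n$ put $B(n)=\max\{N\in\mathbb N : C(N)\le n\}$ and $BP(n)=\max\{N\in\mathbb N : K(N)\le n\}$, where $\max\emptyset=-\infty$. A sequence $y_n$ of reals is lower (upper) semicomputable if $y_n=\lim_k y(n,k)$ for some total computable rational-valued function $y(\cdot,\cdot)$ that is non-decreasing (non-increasing) in $k$. Let $m(k)$, $k\in\mathbb N$, be the a priori probability, i.e. a converging lower semicomputable non-negative series such that every converging lower semicomputable non-negative series is at most $O(1)\cdot m(k)$; for $n\in\mathbb N$ let $BP'(n)$ be the minimal $N\in\mathbb N$ with $\sum_{k>N}m(k)<2^{-n}$. Theorem. For every choice of $D$, $P$, $m$ as above the following hold; $n$ ranges over natural numbers, and the constants $c$ are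 natural numbers that do not depend on $n$. (i) There exists $c$ such that $BP(n)\le BP'(n+c)$ and $BP'(n)\le B(n+c)$ for all $n$. (ii) There exists $c$ such that $B(n)\le BP(n+K(n)+c)$ for all $n$. (iii) Let $(x_n,y_n)$ be a sequence of pairs of natural numbers such that $x_n\le y_n$, the sequence $x_n$ is lower semicomputable, the sequence $y_n$ is upper semicomputable, and $\sum_n 2^{x_n-y_n}<\infty$. Then there exists $c$ such that $B(x_n)\le BP(y_n+c)$ for all $n$. (ii$'$) There exists $c$ such that $B(n-K(n)-c)\le BP(n)$ for all $n$. (iii$'$) Under the assumptions of (iii) there exists $c$ such that $B(x_n-c)\le BP(y_n)$ for all $n$. -/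

import Mathlib

namespace BusyBeaver

/-- The complexity of the natural number `x` with respect to a decompressor `D`: the minimal length
of a binary string `p` with `D p = x`, and `⊤` if there is no such string. -/
noncomputable def complexity (D : List Bool →. ℕ) (x : ℕ) : ℕ∞ :=
  ⨅ (p : List Bool) (_ : x ∈ D p), (p.length : ℕ∞)

/-- An optimal plain decompressor: a partial computable map from binary strings to natural numbers
that minimizes complexity, up to an additive constant, among all such maps. -/
def IsOptimalPlain (D : List Bool →. ℕ) : Prop :=
  Partrec D ∧
    ∀ D' : List Bool →. ℕ, Partrec D' → ∃ c : ℕ, ∀ x, complexity D x ≤ complexity D' x + c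

/-- No element of the domain of `D` is a proper prefix of another element of the domain. -/
def PrefixFree (D : List Bool →. ℕ) : Prop :=
  ∀ p q : List Bool, (D p).Dom → (D q).Dom → p <+: q → p = q

/-- An optimal prefix-free decompressor: a prefix-free partial computable map that minimizes
complexity, up to an additive constant, among all prefix-free partial computable maps. -/
def IsOptimalPrefixFree (D : List Bool →. ℕ) : Prop :=
  Partrec D ∧ PrefixFree D ∧
    ∀ D' : List Bool →. ℕ, Partrec D' → PrefixFree D' →
      ∃ c : ℕ, ∀ x, complexity D x ≤ complexity D' x + c

/-- The set of natural numbers of complexity at most `n`; it is empty when `n < 0`. -/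
def lowComplexity (D : List Bool →. ℕ) (n : ℤ) : Set ℕ :=
  {N | ∃ k : ℕ, complexity D N = k ∧ (k : ℤ) ≤ n}

theorem exists_of_complexity_eq {D : List Bool →. ℕ} {x k : ℕ} (h : complexity D x = k) :
    ∃ p : List Bool, x ∈ D p ∧ p.length ≤ k := by
  have hlt : complexity D x < ((k + 1 : ℕ) : ℕ∞) := by
    rw [h]; exact_mod_cast Nat.lt_succ_self k
  simp only [complexity, iInf_lt_iff] at hlt
  obtain ⟨p, hp, hl⟩ := hlt
  exact ⟨p, hp, Nat.lt_succ_iff.mp (by exact_mod_cast hl)⟩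

theorem lowComplexity_finite (D : List Bool →. ℕ) (n : ℤ) : (lowComplexity D n).Finite := by
  refine ((List.finite_length_le Bool n.toNat).biUnion
    (t := fun p => {N | N ∈ D p}) (fun p _ => ?_)).subset ?_
  · exact Set.Subsingleton.finite fun a ha b hb => Part.mem_unique ha hb
  · rintro N ⟨k, hk, hkn⟩
    obtain ⟨p, hp, hl⟩ := exists_of_complexity_eq hk
    simp only [Set.mem_iUnion]
    exact ⟨p, by simp only [Set.mem_ofPred_eq]; omega, hp⟩

/-- The busy beaver function of a decompressor: the maximal natural number of complexity at most
`n`, and `⊥` (that is, `-∞`) if there is no such number. For an optimal plain decompressor this is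
the plain busy beaver function, for an optimal prefix-free one the prefix busy beaver function. -/
noncomputable def busyBeaver (D : List Bool →. ℕ) (n : ℤ) : WithBot ℕ :=
  (lowComplexity_finite D n).toFinset.max

/-- With an optimal prefix-free decompressor every number has finite complexity, so `ENat.toNat`
does not lose anything. -/
theorem IsOptimalPrefixFree.complexity_ne_top {D : List Bool →. ℕ} (hD : IsOptimalPrefixFree D)
    (x : ℕ) : complexity D x ≠ ⊤ := by
  let f : List Bool → Option ℕ := fun p => List.casesOn p (some x) (fun _ _ => none)
  have hf : Computable f :=
    (Primrec.list_casesOn (f := fun p : List Bool => p) (g := fun _ => some x)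
      (h := fun _ _ => none) Primrec.id (Primrec.const _) (Primrec.const _).to₂).to_comp
  have hp : PrefixFree fun p => Part.ofOption (f p) := by
    intro p q h1 h2 _
    cases p with
    | cons a l => simp [f] at h1
    | nil =>
      cases q with
      | cons a l => simp [f] at h2
      | nil => rfl
  obtain ⟨c, hc⟩ := hD.2.2 _ hf.ofOption hp
  have h0 : complexity (fun p => Part.ofOption (f p)) x ≤ 0 :=
    iInf₂_le_of_le [] (by simp [f]) (by simp)
  have := (hc x).trans (add_le_add_left h0 _)
  intro htop
  rw [htop] at this
  simp at this

/-- A total computable function of two natural arguments with rational values. -/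
def ComputableRat₂ (f : ℕ → ℕ → ℚ) : Prop :=
  ∃ a b d : ℕ → ℕ → ℕ, Computable₂ a ∧ Computable₂ b ∧ Computable₂ d ∧
    ∀ n k, f n k = ((a n k : ℚ) - (b n k : ℚ)) / ((d n k : ℚ) + 1)

/-- A sequence of reals is lower semicomputable if it is the pointwise limit of a total computable
rational-valued function of two arguments that is non-decreasing in the second argument. -/
def LowerSemicomputable (y : ℕ → ℝ) : Prop :=
  ∃ f : ℕ → ℕ → ℚ, ComputableRat₂ f ∧ (∀ n, Monotone (f n)) ∧
    ∀ n, Filter.Tendsto (fun k => (f n k : ℝ)) Filter.atTop (nhds (y n))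

/-- A sequence of reals is upper semicomputable if it is the pointwise limit of a total computable
rational-valued function of two arguments that is non-increasing in the second argument. -/
def UpperSemicomputable (y : ℕ → ℝ) : Prop :=
  ∃ f : ℕ → ℕ → ℚ, ComputableRat₂ f ∧ (∀ n, Antitone (f n)) ∧
    ∀ n, Filter.Tendsto (fun k => (f n k : ℝ)) Filter.atTop (nhds (y n))

/-- A converging lower semicomputable non-negative series. -/
def IsLowerSemicomputableSeries (m : ℕ → ℝ) : Prop :=
  (∀ k, 0 ≤ m k) ∧ Summable m ∧ LowerSemicomputable m

/-- A priori probability: a converging lower semicomputable non-negative series that is maximal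
among such series up to a multiplicative constant. -/
def IsAprioriProbability (m : ℕ → ℝ) : Prop :=
  IsLowerSemicomputableSeries m ∧
    ∀ m' : ℕ → ℝ, IsLowerSemicomputableSeries m' → ∃ C : ℝ, ∀ k, m' k ≤ C * m k

/-- The modulus of convergence of the series `m`: the minimal `N` such that the sum of `m k` over
`k > N` is less than `2 ^ (-n)`. -/
noncomputable def tailBeaver (m : ℕ → ℝ) (n : ℕ) : ℕ :=
  sInf {N : ℕ | ∑' k : ℕ, m (k + (N + 1)) < (2 : ℝ) ^ (-(n : ℤ))}

/-- The minimum in the definition of `tailBeaver` is attained. -/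
theorem tailBeaver_isLeast (m : ℕ → ℝ) (n : ℕ) :
    IsLeast {N : ℕ | ∑' k : ℕ, m (k + (N + 1)) < (2 : ℝ) ^ (-(n : ℤ))} (tailBeaver m n) := by
  have hne : {N : ℕ | ∑' k : ℕ, m (k + (N + 1)) < (2 : ℝ) ^ (-(n : ℤ))}.Nonempty := by
    have ht := (tendsto_sum_nat_add m).comp (Filter.tendsto_add_atTop_nat 1)
    exact (ht.eventually (gt_mem_nhds (by positivity))).exists
  exact ⟨Nat.sInf_mem hne, fun N hN => Nat.sInf_le hN⟩

end BusyBeaver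

/-! The engine for the bounds by BP is the Kraft–Chaitin theorem,
`IsOptimalPrefixFree.exists_complexity_le`: if an enumerable family of requests (l, N) has finite
total weight ∑ 2^(-l), then K(N) ≤ l + O(1) for every request.

For (iii), every program p of length at most x_n requests D(p), if defined, at length y_n. There are
fewer than 2^(x_n+1) such programs, so the total weight is O(∑ 2^(x_n-y_n)). Only upper bounds k of
y_n can be enumerated, so each k ≥ y_n gets a request, at the cost of a geometric series. For (iii')
the constant has to move into the argument of B. Programs of length at most x_n - 2c make requests
at length y_n - c; this saves a factor 2^(-c), so all c fit into one family, with one constant b,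
and c = b cancels it (`IsOptimalPrefixFree.exists_complexity_le_of_summable`). Statements (ii) and
(ii') are the cases (n, n + K(n)) and (max(0, n - K(n)), n), summable by Kraft's inequality.

For the first half of (i), the weights of all programs of N form a lower semicomputable converging
series, so 2^(-K(N)) = O(m(N)), and a number of small complexity cannot lie in a light tail of m.
For the second half, n + O(1) bits of ∑ m suffice to find by search some N whose tail is below
2^(-n). Then C(N) ≤ n + O(1), and N is at least the modulus. -/

namespace BusyBeaver

/-! ### Binary words as big-endian numerals -/

/-- The number with binary notation `p`, most significant digit first. -/
def bitValue (p : List Bool) : ℕ :=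
  p.foldl (fun s b => 2 * s + b.toNat) 0

theorem bitValue_concat (p : List Bool) (b : Bool) :
    bitValue (p ++ [b]) = 2 * bitValue p + b.toNat := by
  simp [bitValue]

theorem bitValue_append (p q : List Bool) :
    bitValue (p ++ q) = bitValue p * 2 ^ q.length + bitValue q := by
  induction q using List.reverseRecOn with
  | nil => simp [bitValue]
  | append_singleton q b ih =>
    rw [← List.append_assoc, bitValue_concat, bitValue_concat, ih]
    simp [pow_succ]; ring

theorem bitValue_lt (p : List Bool) : bitValue p < 2 ^ p.length := by
  induction p using List.reverseRecOn with
  | nil => simp [bitValue]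
  | append_singleton p b ih =>
    rw [bitValue_concat, List.length_append, List.length_singleton, pow_succ]
    cases b <;> simp <;> omega

theorem exists_bitValue_eq (l v : ℕ) (h : v < 2 ^ l) :
    ∃ p : List Bool, p.length = l ∧ bitValue p = v := by
  induction l generalizing v with
  | zero => exact ⟨[], rfl, by simp [bitValue]; omega⟩
  | succ l ih =>
    obtain ⟨p, hp, hv⟩ := ih (v / 2) (by rw [pow_succ] at h; omega)
    refine ⟨p ++ [decide (v % 2 = 1)], by simp [hp], ?_⟩
    rw [bitValue_concat, hv]
    by_cases h2 : v % 2 = 1 <;> simp [h2] <;> omega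

theorem primrec_two_pow : Primrec fun n : ℕ => 2 ^ n :=
  (Primrec₂.unpaired'.1 Nat.Primrec.pow).comp (Primrec.const 2) Primrec.id

theorem primrec_bitValue : Primrec bitValue := by
  refine Primrec.list_foldl (f := fun p : List Bool => p) (g := fun _ => 0)
    (h := fun _ (sb : ℕ × Bool) => 2 * sb.1 + sb.2.toNat) Primrec.id (Primrec.const 0) ?_
  have h : Primrec fun q : List Bool × ℕ × Bool => q.2.2.toNat :=
    (Primrec.dom_bool Bool.toNat).comp (Primrec.snd.comp Primrec.snd)
  exact (Primrec.nat_add.comp (Primrec.nat_mul.comp (Primrec.const 2)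
    (Primrec.fst.comp Primrec.snd)) h).to₂

/-! ### Dyadic partial sums -/

/-- The weight `2 ^ (-l)` of a word of length `l`, and `0` if no word is given. -/
noncomputable def weight (o : Option ℕ) : ℝ :=
  o.elim 0 fun l => (1 / 2) ^ l

@[simp] theorem weight_none : weight none = 0 := rfl

@[simp] theorem weight_some (l : ℕ) : weight (some l) = (1 / 2) ^ l := rfl

theorem weight_nonneg (o : Option ℕ) : 0 ≤ weight o := by
  cases o <;> simp

/-- The dyadic number `s.1 / 2 ^ s.2` increased by the weight of `o`. -/
def addWeight (s : ℕ × ℕ) (o : Option ℕ) : ℕ × ℕ :=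
  Option.casesOn o s fun l => (s.1 * 2 ^ l + 2 ^ s.2, s.2 + l)

/-- Numerator and exponent of the denominator of the partial sums of the weights of `r`. -/
def partialSum (r : ℕ → Option ℕ) (n : ℕ) : ℕ × ℕ :=
  Nat.rec (0, 0) (fun i s => addWeight s (r i)) n

/-- The dyadic number with numerator `s.1` and denominator `2 ^ s.2`. -/
noncomputable def dyadic (s : ℕ × ℕ) : ℝ :=
  s.1 / 2 ^ s.2

theorem dyadic_addWeight (s : ℕ × ℕ) (o : Option ℕ) :
    dyadic (addWeight s o) = dyadic s + weight o := by
  cases o with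
  | none => simp [addWeight]
  | some l =>
    simp only [addWeight, dyadic, weight_some, pow_add, one_div, inv_pow]
    push_cast
    field_simp

theorem dyadic_partialSum (r : ℕ → Option ℕ) (n : ℕ) :
    dyadic (partialSum r n) = ∑ i ∈ Finset.range n, weight (r i) := by
  induction n with
  | zero => simp [partialSum, dyadic]
  | succ n ih => rw [Finset.sum_range_succ, ← ih, ← dyadic_addWeight]; rfl

theorem primrec_addWeight : Primrec₂ addWeight := by
  refine Primrec.option_casesOn (o := fun q : (ℕ × ℕ) × Option ℕ => q.2) (f := fun q => q.1)
    (g := fun q l => (q.1.1 * 2 ^ l + 2 ^ q.1.2, q.1.2 + l)) Primrec.snd Primrec.fst ?_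
  have h1 : Primrec fun a : ((ℕ × ℕ) × Option ℕ) × ℕ => a.1.1.1 :=
    Primrec.fst.comp (Primrec.fst.comp Primrec.fst)
  have h2 : Primrec fun a : ((ℕ × ℕ) × Option ℕ) × ℕ => a.1.1.2 :=
    Primrec.snd.comp (Primrec.fst.comp Primrec.fst)
  exact (Primrec.pair (Primrec.nat_add.comp
    (Primrec.nat_mul.comp h1 (primrec_two_pow.comp Primrec.snd)) (primrec_two_pow.comp h2))
    (Primrec.nat_add.comp h2 Primrec.snd)).to₂

theorem computable_partialSum {α : Type*} [Primcodable α] {r : α → ℕ → Option ℕ}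
    (hr : Computable₂ r) : Computable₂ fun a n => partialSum (r a) n := by
  have h1 : Computable fun q : (α × ℕ) × ℕ × ℕ × ℕ => q.2.2 := Computable.snd.comp Computable.snd
  have h2 : Computable fun q : (α × ℕ) × ℕ × ℕ × ℕ => r q.1.1 q.2.1 :=
    hr.comp (Computable.fst.comp Computable.fst) (Computable.fst.comp Computable.snd)
  have h3 : Computable₂ fun (q : α × ℕ) (is : ℕ × ℕ × ℕ) => addWeight is.2 (r q.1 is.1) :=
    (primrec_addWeight.to_comp.comp h1 h2).to₂
  exact (Computable.nat_rec Computable.snd (Computable.const ((0 : ℕ), (0 : ℕ))) h3).to₂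

/-! ### Enumeration of the graph of a partial computable function -/

/-- The graph of a partial computable function has a computable enumeration without repetitions. -/
theorem exists_enumeration {α β : Type*} [Primcodable α] [Primcodable β] {g : α →. β}
    (hg : Partrec g) : ∃ r : ℕ → Option (α × β), Computable r ∧
      (∀ i a b, r i = some (a, b) → b ∈ g a) ∧ (∀ a b, b ∈ g a → ∃ i, r i = some (a, b)) ∧
      ∀ i j a b b', r i = some (a, b) → r j = some (a, b') → i = j := by
  obtain ⟨c, hc⟩ := Nat.Partrec.Code.exists_code.1 hg
  let ev : ℕ → α → Option ℕ := fun k a => Nat.Partrec.Code.evaln k c (Encodable.encode a)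
  have heval : ∀ a, c.eval (Encodable.encode a) = (g a).map Encodable.encode := by
    intro a; rw [hc]; simp
  have hev : ∀ a b, b ∈ g a ↔ ∃ k, ev k a = some (Encodable.encode b) := by
    intro a b
    have := Nat.Partrec.Code.evaln_complete (c := c) (n := Encodable.encode a)
      (x := Encodable.encode b)
    rw [heval] at this
    simpa [ev] using this
  have hmono : ∀ {k k' : ℕ} {a x}, k ≤ k' → ev k a = some x → ev k' a = some x := by
    intro k k' a x hk h
    exact Nat.Partrec.Code.evaln_mono hk h
  -- A pair is emitted only at the stage where the computation on `a` first halts; hence no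
  -- repetitions.
  let step : ℕ → α → Option (α × β) := fun s a =>
    Option.casesOn (ev s a) ((ev (s + 1) a).bind fun x => (Encodable.decode x).map fun b : β => (a, b))
      fun _ => none
  let r : ℕ → Option (α × β) := fun i => (Encodable.decode₂ α i.unpair.1).bind (step i.unpair.2)
  have hevC : Computable₂ ev := by
    have h : Primrec fun q : ℕ × α => ((q.1, c), Encodable.encode q.2) :=
      Primrec.pair (Primrec.pair Primrec.fst (Primrec.const c)) (Primrec.encode.comp Primrec.snd)
    exact (Nat.Partrec.Code.primrec_evaln.comp h).to_comp.to₂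
  have hstepC : Computable₂ step := by
    refine Computable.option_casesOn (o := fun q : ℕ × α => ev q.1 q.2)
      (f := fun q => (ev (q.1 + 1) q.2).bind fun x => (Encodable.decode x).map fun b : β => (q.2, b))
      (g := fun _ _ => none) hevC ?_ (Computable.const none).to₂
    refine Computable.option_bind (hevC.comp (Computable.succ.comp Computable.fst)
      Computable.snd) ?_
    refine Computable.option_map (f := fun y : (ℕ × α) × ℕ => (Encodable.decode y.2 : Option β))
      (g := fun y b => (y.1.2, b)) (Computable.decode.comp Computable.snd) ?_
    exact (Computable.pair (Computable.snd.comp (Computable.fst.comp Computable.fst))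
      Computable.snd).to₂
  have hrC : Computable r := by
    refine Computable.option_bind (f := fun i : ℕ => Encodable.decode₂ α i.unpair.1)
      (g := fun i a => step i.unpair.2 a)
      (Primrec.decode₂.to_comp.comp (Computable.fst.comp Computable.unpair)) ?_
    exact hstepC.comp (Computable.snd.comp (Computable.unpair.comp Computable.fst)) Computable.snd
  have hr : ∀ i a b, r i = some (a, b) →
      i.unpair.1 = Encodable.encode a ∧ ev i.unpair.2 a = none ∧
        ev (i.unpair.2 + 1) a = some (Encodable.encode b) := by
    intro i a b h
    obtain ⟨a', ha', h⟩ := Option.bind_eq_some_iff.1 h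
    have hi := Encodable.mem_decode₂.1 ha'
    cases hn : ev i.unpair.2 a' with
    | some x => simp [step, hn] at h
    | none =>
      simp only [step, hn, Option.bind_eq_some_iff, Option.map_eq_some_iff, Prod.mk.injEq] at h
      obtain ⟨x, hx, b', hb', rfl, rfl⟩ := h
      obtain ⟨b, -, rfl⟩ := (Part.mem_map_iff _).1
        (heval a' ▸ Nat.Partrec.Code.evaln_sound (Option.mem_def.2 hx))
      rw [Encodable.encodek, Option.some.injEq] at hb'
      exact ⟨hi.symm, hn, hb' ▸ hx⟩
  refine ⟨r, hrC, fun i a b h => (hev a b).2 ⟨_, (hr i a b h).2.2⟩, ?_, ?_⟩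
  · intro a b hab
    have hex := (hev a b).1 hab
    classical
    -- Nothing halts at stage 0, so the first halting stage has a predecessor.
    obtain ⟨s, hs⟩ : ∃ s, Nat.find hex = s + 1 := by
      refine Nat.exists_eq_succ_of_ne_zero fun h0 => ?_
      have := Nat.find_spec hex
      rw [h0] at this
      exact absurd (Nat.Partrec.Code.evaln_bound (Option.mem_def.2 this)) (Nat.not_lt_zero _)
    have hs1 := Nat.find_spec hex
    rw [hs] at hs1
    have hs0 : ev s a = none := by
      cases hn : ev s a with
      | none => rfl
      | some x =>
        have h2 := hmono (Nat.le_succ s) hn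
        rw [Nat.succ_eq_add_one, hs1] at h2
        exact absurd (h2 ▸ hn) (Nat.find_min hex (by omega))
    refine ⟨Nat.pair (Encodable.encode a) s, ?_⟩
    simp [r, step, hs0, hs1]
  · intro i j a b b' hi hj
    obtain ⟨h1, h2, h3⟩ := hr _ _ _ hi
    obtain ⟨h1', h2', h3'⟩ := hr _ _ _ hj
    rcases lt_trichotomy i.unpair.2 j.unpair.2 with h | h | h
    · rw [hmono h h3] at h2'; simp at h2'
    · rw [← Nat.pair_unpair i, ← Nat.pair_unpair j, h1, h1', h]
    · rw [hmono h h3'] at h2; simp at h2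

/-! ### Prefix-free machines from computable requests -/

/-- The numerator of the first multiple of `2 ^ (-(l + 1))` that is not less than `dyadic s`. -/
def codeStart (s : ℕ × ℕ) (l : ℕ) : ℕ :=
  (s.1 * 2 ^ (l + 1) + (2 ^ s.2 - 1)) / 2 ^ s.2

theorem dyadic_le_codeStart (s : ℕ × ℕ) (l : ℕ) :
    dyadic s ≤ codeStart s l / 2 ^ (l + 1) := by
  have hpos : 0 < 2 ^ s.2 := by positivity
  have h := Nat.lt_div_mul_add (a := s.1 * 2 ^ (l + 1) + (2 ^ s.2 - 1)) hpos
  have : s.1 * 2 ^ (l + 1) ≤ codeStart s l * 2 ^ s.2 := by unfold codeStart; omega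
  rw [dyadic, div_le_div_iff₀ (by positivity) (by positivity)]
  exact_mod_cast this

/-- Rounding up to the grid of step 2^(-(l+1)) costs less than one step, and the codeword's interval
takes one more. Together they fit into the reserved 2^(-l), which is why one additional bit is
spent. -/
theorem codeStart_add_one_lt (s : ℕ × ℕ) (l : ℕ) :
    (codeStart s l + 1 : ℝ) / 2 ^ (l + 1) < dyadic s + (1 / 2) ^ l := by
  have hpos : 0 < 2 ^ s.2 := by positivity
  have h := Nat.div_mul_le_self (s.1 * 2 ^ (l + 1) + (2 ^ s.2 - 1)) (2 ^ s.2)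
  have : codeStart s l * 2 ^ s.2 + 1 ≤ s.1 * 2 ^ (l + 1) + 2 ^ s.2 := by unfold codeStart; omega
  have h' : (codeStart s l * 2 ^ s.2 + 1 : ℝ) ≤ s.1 * 2 ^ (l + 1) + 2 ^ s.2 := by
    exact_mod_cast this
  have e : dyadic s + (1 / 2) ^ l = (s.1 * 2 ^ (l + 1) + 2 * 2 ^ s.2) / (2 ^ s.2 * 2 ^ (l + 1)) := by
    rw [dyadic, one_div, inv_pow, pow_succ]; field_simp
  rw [e, div_lt_div_iff₀ (by positivity) (by positivity)]
  have h2 : (0 : ℝ) < 2 ^ (l + 1) := by positivity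
  nlinarith

/-- The number that `p` codes if `p` is the codeword of a request `(l, N)` issued in state `s`. -/
def matchRequest (q : (List Bool × ℕ × ℕ) × ℕ × ℕ) : Option ℕ :=
  if q.1.1.length = q.2.1 + 1 ∧ bitValue q.1.1 = codeStart q.1.2 q.2.1 then some q.2.2 else none

theorem primrec_matchRequest : Primrec matchRequest := by
  have hp : Primrec fun q : (List Bool × ℕ × ℕ) × ℕ × ℕ => q.1.1 := Primrec.fst.comp Primrec.fst
  have hs : Primrec fun q : (List Bool × ℕ × ℕ) × ℕ × ℕ => q.1.2 := Primrec.snd.comp Primrec.fst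
  have hl : Primrec fun q : (List Bool × ℕ × ℕ) × ℕ × ℕ => q.2.1 := Primrec.fst.comp Primrec.snd
  have hl1 : Primrec fun q : (List Bool × ℕ × ℕ) × ℕ × ℕ => q.2.1 + 1 := Primrec.succ.comp hl
  have he := primrec_two_pow.comp (Primrec.snd.comp hs)
  have hc : Primrec fun q : (List Bool × ℕ × ℕ) × ℕ × ℕ => codeStart q.1.2 q.2.1 :=
    Primrec.nat_div.comp (Primrec.nat_add.comp
      (Primrec.nat_mul.comp (Primrec.fst.comp hs) (primrec_two_pow.comp hl1))
      (Primrec.nat_sub.comp he (Primrec.const 1))) he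
  exact Primrec.ite (PrimrecPred.and (Primrec.eq.comp (Primrec.list_length.comp hp) hl1)
    (Primrec.eq.comp (primrec_bitValue.comp hp) hc))
    (Primrec.option_some.comp (Primrec.snd.comp Primrec.snd)) (Primrec.const none)

/-- The Kraft–Chaitin theorem for a computable sequence of requests: if the weights of the requested
lengths sum up to at most `1`, there is a prefix-free machine that satisfies all requests, up to one
additional bit. -/
theorem exists_prefixFree_of_requests {r : ℕ → Option (ℕ × ℕ)} (hr : Computable r)
    (hsum : ∀ n, ∑ i ∈ Finset.range n, weight ((r i).map Prod.fst) ≤ 1) :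
    ∃ M : List Bool →. ℕ, Partrec M ∧ PrefixFree M ∧
      ∀ i l N, r i = some (l, N) → complexity M N ≤ (l + 1 : ℕ) := by
  let S : ℕ → ℕ × ℕ := partialSum fun i => (r i).map Prod.fst
  have hS : Computable S :=
    (computable_partialSum (α := Unit) (r := fun _ i => (r i).map Prod.fst)
      (Computable.option_map (hr.comp Computable.snd)
        (Computable.fst.comp Computable.snd).to₂).to₂).comp (Computable.const ()) Computable.id
  have hSsum : ∀ n, dyadic (S n) = ∑ i ∈ Finset.range n, weight ((r i).map Prod.fst) :=
    dyadic_partialSum _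
  have hSmono : Monotone fun n => dyadic (S n) := by
    refine monotone_nat_of_le_succ fun n => ?_
    rw [hSsum, hSsum, Finset.sum_range_succ]
    linarith [weight_nonneg ((r n).map Prod.fst)]
  let look : List Bool → ℕ → Option ℕ := fun p i => (r i).bind fun x => matchRequest ((p, S i), x)
  have hlook : Computable₂ look := by
    refine Computable.option_bind (f := fun q : List Bool × ℕ => r q.2)
      (g := fun q x => matchRequest ((q.1, S q.2), x)) (hr.comp Computable.snd) ?_
    exact primrec_matchRequest.to_comp.comp (Computable.pair (Computable.pair
      (Computable.fst.comp Computable.fst) (hS.comp (Computable.snd.comp Computable.fst)))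
      Computable.snd)
  have look_iff : ∀ p i N, look p i = some N ↔
      ∃ l, r i = some (l, N) ∧ p.length = l + 1 ∧ bitValue p = codeStart (S i) l := by
    intro p i N
    simp only [look, Option.bind_eq_some_iff, matchRequest]
    constructor
    · rintro ⟨⟨l, N'⟩, h1, h2⟩
      split_ifs at h2 with h
      simp only [Option.some.injEq] at h2
      exact ⟨l, by rw [h1, ← h2], h⟩
    · rintro ⟨l, h1, h2⟩
      exact ⟨(l, N), h1, by rw [if_pos h2]⟩
  have hlow : ∀ p i N, look p i = some N → dyadic (S i) ≤ bitValue p / 2 ^ p.length := by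
    intro p i N h
    obtain ⟨l, -, h1, h2⟩ := (look_iff p i N).1 h
    rw [h1, h2]
    exact dyadic_le_codeStart _ _
  have hhigh : ∀ p i N, look p i = some N →
      (bitValue p + 1 : ℝ) / 2 ^ p.length < dyadic (S (i + 1)) := by
    intro p i N h
    obtain ⟨l, h0, h1, h2⟩ := (look_iff p i N).1 h
    have : dyadic (S (i + 1)) = dyadic (S i) + (1 / 2) ^ l := by
      rw [hSsum, hSsum, Finset.sum_range_succ, h0]; rfl
    rw [h1, h2, this]
    exact codeStart_add_one_lt _ _
  -- A word owns the dyadic interval of its extensions, which lies between two consecutive partial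
  -- sums. A prefix relation nests these intervals, so both words belong to the same request.
  have huniq : ∀ p q i j N N', look p i = some N → look q j = some N' → p <+: q → i = j := by
    rintro p q i j N N' hi hj ⟨t, rfl⟩
    have hp1 := hlow _ _ _ hi
    have hp2 := hhigh _ _ _ hi
    have hq1 := hlow _ _ _ hj
    have hq2 := hhigh _ _ _ hj
    have ht : (bitValue t + 1 : ℝ) ≤ 2 ^ t.length := by exact_mod_cast bitValue_lt t
    have ht0 : (0 : ℝ) ≤ bitValue t := by positivity
    rw [bitValue_append, List.length_append, pow_add] at hq1 hq2
    push_cast at hq1 hq2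
    have e1 : ((bitValue p : ℝ) * 2 ^ t.length + bitValue t) / (2 ^ p.length * 2 ^ t.length) ≤
        (bitValue p + 1) / 2 ^ p.length := by
      rw [div_le_div_iff₀ (by positivity) (by positivity)]
      have : (0 : ℝ) < 2 ^ p.length := by positivity
      nlinarith
    have e2 : (bitValue p : ℝ) / 2 ^ p.length ≤
        (bitValue p * 2 ^ t.length + bitValue t + 1) / (2 ^ p.length * 2 ^ t.length) := by
      rw [div_le_div_iff₀ (by positivity) (by positivity)]
      have : (0 : ℝ) < 2 ^ p.length := by positivity
      nlinarith
    rcases lt_trichotomy i j with h | h | h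
    · have := hSmono (Nat.succ_le_of_lt h)
      simp only [Nat.succ_eq_add_one] at this
      linarith
    · exact h
    · have := hSmono (Nat.succ_le_of_lt h)
      simp only [Nat.succ_eq_add_one] at this
      linarith
  refine ⟨fun p => Nat.rfindOpt (look p), Partrec.rfindOpt hlook, ?_, ?_⟩
  · intro p q hp hq hpq
    obtain ⟨i, N, hi⟩ := Nat.rfindOpt_dom.1 hp
    obtain ⟨j, N', hj⟩ := Nat.rfindOpt_dom.1 hq
    obtain rfl := huniq _ _ _ _ _ _ hi hj hpq
    obtain ⟨l, h0, h1, -⟩ := (look_iff _ _ _).1 hi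
    obtain ⟨l', h0', h1', -⟩ := (look_iff _ _ _).1 hj
    rw [h0] at h0'
    simp only [Option.some.injEq, Prod.mk.injEq] at h0'
    exact hpq.eq_of_length (by rw [h1, h1', h0'.1])
  · intro i l N hi
    have hlt : codeStart (S i) l < 2 ^ (l + 1) := by
      have h1 := codeStart_add_one_lt (S i) l
      have h2 : dyadic (S i) + (1 / 2) ^ l ≤ 1 := by
        have := hsum (i + 1)
        rw [Finset.sum_range_succ, hi, ← hSsum] at this
        exact this
      have h3 := h1.trans_le h2
      rw [div_lt_one (by positivity)] at h3
      have h4 : codeStart (S i) l + 1 < 2 ^ (l + 1) := by exact_mod_cast h3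
      omega
    obtain ⟨p, hpl, hpv⟩ := exists_bitValue_eq _ _ hlt
    have hlk : look p i = some N := (look_iff _ _ _).2 ⟨l, hi, hpl, hpv⟩
    have hdom : (Nat.rfindOpt (look p)).Dom := Nat.rfindOpt_dom.2 ⟨i, N, hlk⟩
    obtain ⟨j, hj⟩ := Nat.rfindOpt_spec (Part.get_mem hdom)
    -- Only one request matches `p`, so the search cannot return the number of another one.
    obtain rfl := huniq _ _ _ _ _ _ hlk hj (List.prefix_refl p)
    have hN : N ∈ Nat.rfindOpt (look p) := by
      have := Part.get_mem hdom
      rw [Option.mem_def, hlk, Option.some.injEq] at hj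
      rwa [← hj] at this
    exact iInf₂_le_of_le p hN (by rw [hpl])

/-! ### The Kraft–Chaitin theorem -/

/-- An enumeration without repetitions of requests has total weight at most the sum of any bound for
the weights. -/
theorem sum_weight_le_tsum {α : Type*} {r : ℕ → Option (α × ℕ × ℕ)}
    (hinj : ∀ i j a b b', r i = some (a, b) → r j = some (a, b') → i = j) {u : α → ℝ}
    (hu : Summable u) (hu0 : ∀ a, 0 ≤ u a)
    (hbound : ∀ i a l N, r i = some (a, l, N) → (1 / 2) ^ l ≤ u a) (s : Finset ℕ) :
    ∑ i ∈ s, weight ((r i).map fun x => x.2.1) ≤ ∑' a, u a := by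
  classical
  rcases isEmpty_or_nonempty α with hα | hα
  · have : ∀ i, r i = none := fun i => Option.eq_none_iff_forall_ne_some.2 fun x => isEmptyElim x.1
    simp [this]
  -- The default value is harmless: `φ` is used only on `t`, where `r i` is defined.
  let φ : ℕ → α := fun i => ((r i).map Prod.fst).getD (Classical.arbitrary α)
  let t := s.filter fun i => (r i).isSome
  have hφ : Set.InjOn φ t := by
    intro i hi j hj hij
    obtain ⟨⟨a, b⟩, ha⟩ := Option.isSome_iff_exists.1 (Finset.mem_filter.1 hi).2
    obtain ⟨⟨a', b'⟩, ha'⟩ := Option.isSome_iff_exists.1 (Finset.mem_filter.1 hj).2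
    simp only [φ, ha, ha', Option.map_some, Option.getD_some] at hij
    exact hinj i j a b b' ha (hij ▸ ha')
  calc ∑ i ∈ s, weight ((r i).map fun x => x.2.1)
      = ∑ i ∈ t, weight ((r i).map fun x => x.2.1) := by
        refine (Finset.sum_filter_of_ne fun i _ h => ?_).symm
        cases hri : r i with
        | none => simp [hri] at h
        | some x => rfl
    _ ≤ ∑ i ∈ t, u (φ i) := by
        refine Finset.sum_le_sum fun i hi => ?_
        obtain ⟨⟨a, l, N⟩, ha⟩ := Option.isSome_iff_exists.1 (Finset.mem_filter.1 hi).2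
        simpa [φ, ha] using hbound i a l N ha
    _ = ∑ a ∈ t.image φ, u a := (Finset.sum_image hφ).symm
    _ ≤ ∑' a, u a := hu.sum_le_tsum _ fun a _ => hu0 a

/-- The Kraft–Chaitin theorem for a partial computable family of requests: if the weights of the
requested lengths are summable, all requests are satisfied by an optimal prefix-free decompressor,
up to an additive constant. -/
theorem IsOptimalPrefixFree.exists_complexity_le {P : List Bool →. ℕ} (hP : IsOptimalPrefixFree P)
    {α : Type*} [Primcodable α] {g : α →. ℕ × ℕ} (hg : Partrec g) {u : α → ℝ} (hu : Summable u)
    (hu0 : ∀ a, 0 ≤ u a) (hbound : ∀ a l N, (l, N) ∈ g a → (1 / 2) ^ l ≤ u a) :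
    ∃ c : ℕ, ∀ a l N, (l, N) ∈ g a → complexity P N ≤ (l + c : ℕ) := by
  obtain ⟨r, hrC, hr1, hr2, hr3⟩ := exists_enumeration hg
  -- Lengthening every request by `d` scales the total weight to at most 1.
  obtain ⟨d, hd⟩ := pow_unbounded_of_one_lt (∑' a, u a) (one_lt_two (α := ℝ))
  let r' : ℕ → Option (ℕ × ℕ) := fun i => (r i).map fun x => (x.2.1 + d, x.2.2)
  have hr' : Computable r' := by
    refine Computable.option_map (g := fun (_ : ℕ) (x : α × ℕ × ℕ) => (x.2.1 + d, x.2.2)) hrC ?_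
    have h2 : Computable fun q : ℕ × α × ℕ × ℕ => q.2.2 := Computable.snd.comp Computable.snd
    exact (Computable.pair (Primrec.nat_add.to_comp.comp (Computable.fst.comp h2)
      (Computable.const d)) (Computable.snd.comp h2)).to₂
  have hw : ∀ i, weight ((r' i).map Prod.fst) =
      weight ((r i).map fun x => x.2.1) * (1 / 2) ^ d := by
    intro i
    cases h : r i <;> simp [r', h, pow_add]
  obtain ⟨M, hM, hMp, hMc⟩ := exists_prefixFree_of_requests hr' fun n => by
    simp_rw [hw, ← Finset.sum_mul]
    have := sum_weight_le_tsum hr3 hu hu0 (fun i a l N h => hbound a l N (hr1 _ _ _ h))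
      (Finset.range n)
    calc _ ≤ (2 : ℝ) ^ d * (1 / 2) ^ d := by gcongr; exact this.trans hd.le
      _ = 1 := by rw [← mul_pow]; norm_num
  obtain ⟨c, hc⟩ := hP.2.2 M hM hMp
  refine ⟨d + 1 + c, fun a l N h => ?_⟩
  obtain ⟨i, hi⟩ := hr2 _ _ h
  calc complexity P N ≤ complexity M N + c := hc N
    _ ≤ ((l + d + 1 : ℕ) : ℕ∞) + c := by
        gcongr
        exact hMc i (l + d) N (by simp [r', hi])
    _ = (l + (d + 1 + c) : ℕ) := by push_cast; ring

/-! ### Requests with semicomputable lengths -/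

open scoped ENNReal

theorem tsum_length_le (X : ℕ) (V : ℝ≥0∞) :
    ∑' p : List Bool, (if p.length ≤ X then V else 0) ≤ 2 ^ (X + 1) * V := by
  classical
  let s : Finset (List Bool) := (Finset.range (X + 1)).biUnion fun i =>
    (Finset.univ : Finset (List.Vector Bool i)).image List.Vector.toList
  have hs : ∀ p, p.length ≤ X → p ∈ s := by
    intro p hp
    simp only [s, Finset.mem_biUnion, Finset.mem_range, Finset.mem_image, Finset.mem_univ, true_and]
    exact ⟨p.length, by omega, ⟨p, rfl⟩, rfl⟩
  have hcard : s.card ≤ 2 ^ (X + 1) := by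
    calc s.card ≤ ∑ i ∈ Finset.range (X + 1), 2 ^ i := by
          refine Finset.card_biUnion_le.trans (Finset.sum_le_sum fun i _ => ?_)
          refine Finset.card_image_le.trans ?_
          rw [Finset.card_univ, card_vector, Fintype.card_bool]
      _ ≤ 2 ^ (X + 1) := by rw [Nat.geomSum_eq le_rfl]; simp
  rw [tsum_eq_sum (s := s) fun p hp => if_neg fun h => hp (hs p h)]
  calc _ ≤ ∑ p ∈ s, V := Finset.sum_le_sum fun p _ => by split_ifs <;> simp
    _ = s.card * V := by simp
    _ ≤ 2 ^ (X + 1) * V := by gcongr; exact_mod_cast hcard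

theorem tsum_geometric_tail (y c : ℕ) (h : c ≤ y) :
    ∑' k : ℕ, (if y ≤ k then (2⁻¹ : ℝ≥0∞) ^ (k - c) else 0) = 2 * 2⁻¹ ^ (y - c) := by
  rw [← (add_left_injective y).tsum_eq]
  · have : ∀ k, (if y ≤ k + y then (2⁻¹ : ℝ≥0∞) ^ (k + y - c) else 0) = 2⁻¹ ^ k * 2⁻¹ ^ (y - c) := by
      intro k
      rw [if_pos (by omega), ← pow_add, Nat.add_sub_assoc h]
    simp_rw [this]
    rw [ENNReal.tsum_mul_right, ENNReal.tsum_geometric, ENNReal.one_sub_inv_two, inv_inv]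
  · intro k hk
    simp only [Function.mem_support, ne_eq, ite_eq_right_iff, Classical.not_imp] at hk
    exact ⟨k - y, by simp [hk.1]⟩

theorem two_pow_mul_inv (a : ℕ) : (2 : ℝ≥0∞) ^ a * 2⁻¹ ^ a = 1 := by
  rw [← mul_pow, ENNReal.mul_inv_cancel (by simp) (by simp), one_pow]

/-- At most 2^(X-2c+1) words qualify, and each contributes a geometric tail 2 · 2^(-(Y-c)). The
surplus factor 2^(-c) is what makes the sum over `c` converge. -/
theorem tsum_requests_le (X Y c : ℕ) (h : X ≤ Y) :
    ∑' q : List Bool × ℕ,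
      (if q.1.length + 2 * c ≤ X ∧ Y ≤ q.2 then (2⁻¹ : ℝ≥0∞) ^ (q.2 - c) else 0) ≤
    4 * 2⁻¹ ^ c * 2⁻¹ ^ (Y - X) := by
  by_cases hc : 2 * c ≤ X
  · rw [ENNReal.tsum_prod']
    have : ∀ p : List Bool, ∑' k : ℕ,
        (if p.length + 2 * c ≤ X ∧ Y ≤ k then (2⁻¹ : ℝ≥0∞) ^ (k - c) else 0) =
        if p.length ≤ X - 2 * c then 2 * 2⁻¹ ^ (Y - c) else 0 := by
      intro p
      by_cases hp : p.length ≤ X - 2 * c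
      · rw [if_pos hp, ← tsum_geometric_tail Y c (by omega)]
        refine tsum_congr fun k => ?_
        simp only [(by omega : p.length + 2 * c ≤ X), true_and]
      · rw [if_neg hp, ENNReal.tsum_eq_zero]
        intro k
        rw [if_neg (by omega)]
    simp_rw [this]
    refine (tsum_length_le _ _).trans (le_of_eq ?_)
    rw [show Y - c = (X - 2 * c) + (c + (Y - X)) by omega, pow_succ, pow_add, pow_add]
    calc _ = ((2 : ℝ≥0∞) ^ (X - 2 * c) * 2⁻¹ ^ (X - 2 * c)) * ((2 * 2) * 2⁻¹ ^ c * 2⁻¹ ^ (Y - X)) := by ring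
      _ = _ := by rw [two_pow_mul_inv, one_mul]; norm_num
  · rw [ENNReal.tsum_eq_zero.2 fun q => if_neg (by omega)]
    exact zero_le

/-- If `x n ≤ y n` are lower and upper semicomputable and `2 ^ (x n - y n)` is summable, then every
number with a program of length at most `x n - 2 * c` has prefix complexity at most `y n - c`, up to
a constant that does not depend on `n` and `c`. -/
theorem IsOptimalPrefixFree.exists_complexity_le_of_summable {D P : List Bool →. ℕ}
    (hD : Partrec D) (hP : IsOptimalPrefixFree P) {x y : ℕ → ℕ} (hxy : ∀ n, x n ≤ y n)
    (hx : REPred fun q : ℕ × ℕ => q.2 ≤ x q.1) (hy : REPred fun q : ℕ × ℕ => y q.1 ≤ q.2)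
    (hs : Summable fun n => (1 / 2 : ℝ) ^ (y n - x n)) :
    ∃ b : ℕ, ∀ n c p N, N ∈ D p → p.length + 2 * c ≤ x n →
      complexity P N ≤ (y n - c + b : ℕ) := by
  -- An index ((c, n), p, k) waits until the bounds |p| + 2c ≤ x n and y n ≤ k are confirmed and `D
  -- p` halts, then requests the output at length k - c.
  let g : (ℕ × ℕ) × List Bool × ℕ →. ℕ × ℕ := fun q =>
    (Part.assert (q.2.1.length + 2 * q.1.1 ≤ x q.1.2) fun _ => Part.some ()).bind fun _ =>
      (Part.assert (y q.1.2 ≤ q.2.2) fun _ => Part.some ()).bind fun _ =>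
        (D q.2.1).map fun N => (q.2.2 - q.1.1, N)
  have hgm : ∀ c n p k l N, (l, N) ∈ g ((c, n), p, k) ↔
      p.length + 2 * c ≤ x n ∧ y n ≤ k ∧ l = k - c ∧ N ∈ D p := by
    intro c n p k l N
    simp only [g, Part.mem_bind_iff, Part.mem_assert_iff, Part.mem_some_iff, Part.mem_map_iff,
      Prod.mk.injEq]
    constructor
    · rintro ⟨-, ⟨h1, -⟩, -, ⟨h2, -⟩, N', h3, h4, rfl⟩
      exact ⟨h1, h2, h4.symm, h3⟩
    · rintro ⟨h1, h2, h3, h4⟩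
      exact ⟨(), ⟨h1, trivial⟩, (), ⟨h2, trivial⟩, N, h4, h3.symm, rfl⟩
  have hg : Partrec g := by
    have h1 : Computable fun q : (ℕ × ℕ) × List Bool × ℕ =>
        (q.1.2, q.2.1.length + 2 * q.1.1) :=
      (Primrec.pair (Primrec.snd.comp Primrec.fst) (Primrec.nat_add.comp
        (Primrec.list_length.comp (Primrec.fst.comp Primrec.snd))
        (Primrec.nat_mul.comp (Primrec.const 2) (Primrec.fst.comp Primrec.fst)))).to_comp
    have h2 : Computable fun q : (ℕ × ℕ) × List Bool × ℕ => (q.1.2, q.2.2) :=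
      (Primrec.pair (Primrec.snd.comp Primrec.fst) (Primrec.snd.comp Primrec.snd)).to_comp
    have h3 : Computable₂ fun (q : (ℕ × ℕ) × List Bool × ℕ) (N : ℕ) => (q.2.2 - q.1.1, N) :=
      (Primrec.pair (Primrec.nat_sub.comp
        (Primrec.snd.comp (Primrec.snd.comp Primrec.fst))
        (Primrec.fst.comp (Primrec.fst.comp Primrec.fst))) Primrec.snd).to_comp.to₂
    have h4 : Partrec fun q : (ℕ × ℕ) × List Bool × ℕ =>
        (D q.2.1).map fun N => (q.2.2 - q.1.1, N) :=
      Partrec.map (hD.comp (Computable.fst.comp Computable.snd)) h3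
    have h5 := Partrec.bind (Partrec.comp hy h2) (h4.comp Computable.fst).to₂
    exact Partrec.bind (Partrec.comp hx h1) (h5.comp Computable.fst).to₂
  let u : (ℕ × ℕ) × List Bool × ℕ → ℝ≥0∞ := fun q =>
    if q.2.1.length + 2 * q.1.1 ≤ x q.1.2 ∧ y q.1.2 ≤ q.2.2 then 2⁻¹ ^ (q.2.2 - q.1.1) else 0
  have hu : ∑' q, u q ≠ ⊤ := by
    have hs' : ∑' n, (2⁻¹ : ℝ≥0∞) ^ (y n - x n) ≠ ⊤ := by
      have := hs.tsum_ofReal_ne_top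
      convert this using 3 with n
      rw [ENNReal.ofReal_pow (by positivity), one_div, ENNReal.ofReal_inv_of_pos two_pos,
        ENNReal.ofReal_ofNat]
    refine ne_top_of_le_ne_top (b := ∑' c : ℕ, ∑' n : ℕ, 4 * 2⁻¹ ^ c * 2⁻¹ ^ (y n - x n)) ?_ ?_
    · simp_rw [ENNReal.tsum_mul_left, ENNReal.tsum_mul_right, ENNReal.tsum_mul_left]
      rw [ENNReal.tsum_geometric, ENNReal.one_sub_inv_two, inv_inv]
      exact ENNReal.mul_ne_top (ENNReal.mul_ne_top (by simp) (by simp)) hs'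
    · rw [ENNReal.tsum_prod', ENNReal.tsum_prod']
      exact ENNReal.tsum_le_tsum fun c => ENNReal.tsum_le_tsum fun n =>
        tsum_requests_le _ _ _ (hxy n)
  obtain ⟨b, hb⟩ := hP.exists_complexity_le hg (ENNReal.summable_toReal hu)
    (fun _ => ENNReal.toReal_nonneg) (by
      rintro ⟨⟨c, n⟩, p, k⟩ l N h
      obtain ⟨h1, h2, rfl, -⟩ := (hgm _ _ _ _ _ _).1 h
      simp only [u]
      rw [if_pos ⟨h1, h2⟩]
      simp)
  -- The requests with k > y n only pay for not knowing y n; the bound comes from k = y n.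
  exact ⟨b, fun n c p N hN h => hb ((c, n), p, y n) _ N ((hgm _ _ _ _ _ _).2 ⟨h, le_rfl, rfl, hN⟩)⟩

/-! ### Recursively enumerable relations -/

theorem rePred_exists {α : Type*} [Primcodable α] {f : α → ℕ → Bool} (hf : Computable₂ f) :
    REPred fun a => ∃ i, f a i = true :=
  (Partrec.rfind hf.partrec₂).dom_re.of_eq fun a => by simp

/-- For integers, k ≤ x n means k - 1 < x n. The strict inequality is eventually witnessed by an
approximation, even if the limit is never attained. -/
theorem LowerSemicomputable.rePred {x : ℕ → ℕ} (h : LowerSemicomputable fun n => (x n : ℝ)) :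
    REPred fun q : ℕ × ℕ => q.2 ≤ x q.1 := by
  obtain ⟨f, ⟨a, b, d, ha, hb, hd, hf⟩, hmono, hlim⟩ := h
  have hC : Computable₂ fun (q : ℕ × ℕ) (s : ℕ) =>
      decide (q.2 * (d q.1 s + 1) + b q.1 s < a q.1 s + (d q.1 s + 1)) := by
    have h1 : Computable fun z : (ℕ × ℕ) × ℕ => z.1.1 := Computable.fst.comp Computable.fst
    have hd' : Computable fun z : (ℕ × ℕ) × ℕ => d z.1.1 z.2 + 1 :=
      Computable.succ.comp (hd.comp h1 Computable.snd)
    have hl : Computable fun z : (ℕ × ℕ) × ℕ => z.1.2 * (d z.1.1 z.2 + 1) + b z.1.1 z.2 :=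
      Primrec.nat_add.to_comp.comp (Primrec.nat_mul.to_comp.comp
        (Computable.snd.comp Computable.fst) hd') (hb.comp h1 Computable.snd)
    have hr : Computable fun z : (ℕ × ℕ) × ℕ => a z.1.1 z.2 + (d z.1.1 z.2 + 1) :=
      Primrec.nat_add.to_comp.comp (ha.comp h1 Computable.snd) hd'
    exact (Primrec.nat_lt.decide.to_comp.comp hl hr).to₂
  refine (rePred_exists hC).of_eq fun ⟨n, k⟩ => ?_
  have key : ∀ s, k * (d n s + 1) + b n s < a n s + (d n s + 1) ↔ (k : ℝ) < f n s + 1 := by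
    intro s
    have hpos : (0 : ℝ) < d n s + 1 := by positivity
    rw [hf, ← sub_lt_iff_lt_add]
    push_cast
    rw [lt_div_iff₀ hpos, ← @Nat.cast_lt ℝ]
    push_cast
    constructor <;> intro h <;> linarith
  simp only [decide_eq_true_eq, key]
  constructor
  · rintro ⟨s, hs⟩
    have h1 : (f n s : ℝ) ≤ x n :=
      (Rat.cast_mono.comp (hmono n)).ge_of_tendsto (hlim n) s
    have : (k : ℝ) < x n + 1 := by linarith
    exact Nat.lt_succ_iff.1 (by exact_mod_cast this)
  · intro h
    have : (k : ℝ) - 1 < x n := by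
      have : (k : ℝ) ≤ x n := by exact_mod_cast h
      linarith
    obtain ⟨s, hs⟩ := ((hlim n).eventually (lt_mem_nhds this)).exists
    exact ⟨s, by linarith⟩

theorem UpperSemicomputable.rePred {y : ℕ → ℕ} (h : UpperSemicomputable fun n => (y n : ℝ)) :
    REPred fun q : ℕ × ℕ => y q.1 ≤ q.2 := by
  obtain ⟨f, ⟨a, b, d, ha, hb, hd, hf⟩, hmono, hlim⟩ := h
  have hC : Computable₂ fun (q : ℕ × ℕ) (s : ℕ) =>
      decide (a q.1 s < (q.2 + 1) * (d q.1 s + 1) + b q.1 s) := by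
    have h1 : Computable fun z : (ℕ × ℕ) × ℕ => z.1.1 := Computable.fst.comp Computable.fst
    have hl : Computable fun z : (ℕ × ℕ) × ℕ => (z.1.2 + 1) * (d z.1.1 z.2 + 1) + b z.1.1 z.2 :=
      Primrec.nat_add.to_comp.comp (Primrec.nat_mul.to_comp.comp
        (Computable.succ.comp (Computable.snd.comp Computable.fst))
        (Computable.succ.comp (hd.comp h1 Computable.snd))) (hb.comp h1 Computable.snd)
    exact (Primrec.nat_lt.decide.to_comp.comp (ha.comp h1 Computable.snd) hl).to₂
  refine (rePred_exists hC).of_eq fun ⟨n, k⟩ => ?_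
  have key : ∀ s, a n s < (k + 1) * (d n s + 1) + b n s ↔ (f n s : ℝ) < k + 1 := by
    intro s
    have hpos : (0 : ℝ) < d n s + 1 := by positivity
    rw [hf]
    push_cast
    rw [div_lt_iff₀ hpos, ← @Nat.cast_lt ℝ]
    push_cast
    constructor <;> intro h <;> linarith
  simp only [decide_eq_true_eq, key]
  constructor
  · rintro ⟨s, hs⟩
    have h1 : (y n : ℝ) ≤ f n s :=
      (Rat.cast_mono.comp_antitone (hmono n)).le_of_tendsto (hlim n) s
    have : (y n : ℝ) < k + 1 := by linarith
    exact Nat.lt_succ_iff.1 (by exact_mod_cast this)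
  · intro h
    have : (y n : ℝ) < k + 1 := by
      have : (y n : ℝ) ≤ k := by exact_mod_cast h
      linarith
    exact ((hlim n).eventually (gt_mem_nhds this)).exists

theorem complexity_le_iff {D : List Bool →. ℕ} {x k : ℕ} :
    complexity D x ≤ k ↔ ∃ p : List Bool, x ∈ D p ∧ p.length ≤ k := by
  constructor
  · intro h
    obtain ⟨j, hj⟩ := ENat.ne_top_iff_exists.1 (ne_top_of_le_ne_top (ENat.natCast_ne_top k) h)
    obtain ⟨p, hp, hl⟩ := exists_of_complexity_eq hj.symm
    rw [← hj] at h
    exact ⟨p, hp, hl.trans (by exact_mod_cast h)⟩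
  · rintro ⟨p, hp, hl⟩
    exact iInf₂_le_of_le p hp (by exact_mod_cast hl)

/-- Searching the enumerated graph of `D` confirms upper bounds on complexity; this supplies the
semicomputability needed when K(n) enters x_n or y_n. -/
theorem rePred_exists_program {D : List Bool →. ℕ} (hD : Partrec D) {R : ℕ × ℕ → ℕ → Bool}
    (hR : Computable₂ R) :
    REPred fun q : ℕ × ℕ => ∃ p : List Bool, q.1 ∈ D p ∧ R q p.length = true := by
  obtain ⟨r, hr, hr1, hr2, -⟩ := exists_enumeration hD
  have hC : Computable₂ fun (q : ℕ × ℕ) (i : ℕ) =>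
      ((r i).map fun x => decide (x.2 = q.1) && R q x.1.length).getD false := by
    have h2 : Computable₂ fun (z : (ℕ × ℕ) × ℕ) (x : List Bool × ℕ) =>
        decide (x.2 = z.1.1) && R z.1 x.1.length := by
      have hz : Computable fun w : ((ℕ × ℕ) × ℕ) × List Bool × ℕ => w.1.1 :=
        Computable.fst.comp Computable.fst
      exact (Primrec.and.to_comp.comp (Primrec.eq.decide.to_comp.comp
        (Computable.snd.comp Computable.snd) (Computable.fst.comp hz)) (hR.comp hz
          (Computable.list_length.comp (Computable.fst.comp Computable.snd)))).to₂
    exact (Computable.option_getD (Computable.option_map (hr.comp Computable.snd) h2)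
      (Computable.const false)).to₂
  refine (rePred_exists hC).of_eq fun q => ?_
  constructor
  · rintro ⟨i, hi⟩
    cases h : r i with
    | none => simp [h] at hi
    | some x =>
      simp only [h, Option.map_some, Option.getD_some, Bool.and_eq_true, decide_eq_true_eq] at hi
      exact ⟨x.1, hi.1 ▸ hr1 i x.1 x.2 h, hi.2⟩
  · rintro ⟨p, hp, hl⟩
    obtain ⟨i, hi⟩ := hr2 p q.1 hp
    exact ⟨i, by simpa [hi] using hl⟩

/-! ### Busy beaver functions -/

theorem le_busyBeaver {D : List Bool →. ℕ} {N k : ℕ} {z : ℤ} (h : complexity D N ≤ k)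
    (hk : (k : ℤ) ≤ z) : (N : WithBot ℕ) ≤ busyBeaver D z := by
  obtain ⟨j, hj⟩ := ENat.ne_top_iff_exists.1 (ne_top_of_le_ne_top (ENat.natCast_ne_top k) h)
  rw [← hj] at h
  have h' : j ≤ k := by exact_mod_cast h
  refine Finset.le_max ((Set.Finite.mem_toFinset _).2 ⟨j, hj.symm, by omega⟩)

theorem busyBeaver_le {D : List Bool →. ℕ} {z : ℤ} {B : WithBot ℕ}
    (h : ∀ N p, N ∈ D p → (p.length : ℤ) ≤ z → (N : WithBot ℕ) ≤ B) : busyBeaver D z ≤ B := by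
  refine Finset.max_le fun N hN => ?_
  obtain ⟨k, hk, hkz⟩ := (Set.Finite.mem_toFinset _).1 hN
  obtain ⟨p, hp, hl⟩ := exists_of_complexity_eq hk
  exact h N p hp (by omega)

theorem busyBeaver_mono (D : List Bool →. ℕ) {z z' : ℤ} (h : z ≤ z') :
    busyBeaver D z ≤ busyBeaver D z' :=
  busyBeaver_le fun _ _ hp hl => le_busyBeaver (complexity_le_iff.2 ⟨_, hp, le_rfl⟩) (hl.trans h)

theorem IsOptimalPrefixFree.exists_busyBeaver_le {D P : List Bool →. ℕ} (hD : Partrec D)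
    (hP : IsOptimalPrefixFree P) {x y : ℕ → ℕ} (hxy : ∀ n, x n ≤ y n)
    (hx : REPred fun q : ℕ × ℕ => q.2 ≤ x q.1) (hy : REPred fun q : ℕ × ℕ => y q.1 ≤ q.2)
    (hs : Summable fun n => (1 / 2 : ℝ) ^ (y n - x n)) :
    (∃ c : ℕ, ∀ n : ℕ, busyBeaver D (x n) ≤ busyBeaver P (y n + c)) ∧
      ∃ c : ℕ, ∀ n : ℕ, busyBeaver D (x n - c) ≤ busyBeaver P (y n) := by
  obtain ⟨b, hb⟩ := hP.exists_complexity_le_of_summable hD hxy hx hy hs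
  -- The first bound uses shift 0. The second uses shift `b`, which cancels the additive `b` in the
  -- length and costs 2b in the argument.
  refine ⟨⟨b, fun n => busyBeaver_le fun N p hp hl => ?_⟩,
    2 * b, fun n => busyBeaver_le fun N p hp hl => ?_⟩
  · exact le_busyBeaver (hb n 0 p N hp (by omega)) (by push_cast; omega)
  · have := hxy n
    exact le_busyBeaver (hb n b p N hp (by push_cast at hl; omega)) (by push_cast at hl; omega)

/-! ### The Kraft inequality -/

/-- The first words of two equal concatenations are prefixes of one word, hence comparable, hence
equal. The empty word is excluded because inserting it does not change a concatenation. -/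
theorem PrefixFree.uniquelyDecodable {D : List Bool →. ℕ} (hD : PrefixFree D)
    (hnil : ¬ (D []).Dom) : InformationTheory.UniquelyDecodable {p | (D p).Dom} := by
  intro L₁
  induction L₁ with
  | nil =>
    intro L₂ _ h2 h
    cases L₂ with
    | nil => rfl
    | cons q L₂ =>
      have hq : (D q).Dom := h2 q (by simp)
      simp only [List.flatten_nil, List.flatten_cons] at h
      rw [(List.append_eq_nil_iff.1 h.symm).1] at hq
      exact absurd hq hnil
  | cons p L₁ ih =>
    intro L₂ h1 h2 h
    have hp : (D p).Dom := h1 p (by simp)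
    cases L₂ with
    | nil =>
      simp only [List.flatten_nil, List.flatten_cons] at h
      rw [(List.append_eq_nil_iff.1 h).1] at hp
      exact absurd hp hnil
    | cons q L₂ =>
      have hq : (D q).Dom := h2 q (by simp)
      simp only [List.flatten_cons] at h
      have hpq : p = q := by
        have hp' : p <+: q ++ L₂.flatten := h ▸ List.prefix_append _ _
        rcases List.prefix_or_prefix_of_prefix hp' (List.prefix_append q L₂.flatten) with h' | h'
        · exact hD p q hp hq h'
        · exact (hD q p hq hp h').symm
      subst hpq
      rw [ih L₂ (fun w hw => h1 w (by simp [hw])) (fun w hw => h2 w (by simp [hw]))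
        (List.append_cancel_left h)]

open Classical in
theorem PrefixFree.summable {D : List Bool →. ℕ} (hD : PrefixFree D) :
    Summable fun p : List Bool => if (D p).Dom then (1 / 2 : ℝ) ^ p.length else 0 := by
  refine summable_of_sum_le (c := 1) (fun p => by split_ifs <;> positivity) fun s => ?_
  rw [← Finset.sum_filter]
  -- If the empty word is in the domain, it is the whole domain; otherwise the Kraft–McMillan
  -- inequality applies.
  by_cases hnil : (D []).Dom
  · have : s.filter (fun p => (D p).Dom) ⊆ {[]} := fun p hp =>
      Finset.mem_singleton.2 (hD [] p hnil (Finset.mem_filter.1 hp).2 List.nil_prefix).symm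
    refine (Finset.sum_le_sum_of_subset_of_nonneg this fun _ _ _ => by positivity).trans ?_
    simp
  · have := InformationTheory.kraft_mcmillan_inequality (S := s.filter fun p => (D p).Dom)
      fun L₁ L₂ h1 h2 => hD.uniquelyDecodable hnil L₁ L₂
        (fun w hw => (Finset.mem_filter.1 (h1 w hw)).2)
        (fun w hw => (Finset.mem_filter.1 (h2 w hw)).2)
    simpa using this

theorem toNat_complexity_le {D : List Bool →. ℕ} {n : ℕ} {p : List Bool} (hp : n ∈ D p) :
    (complexity D n).toNat ≤ p.length :=
  ENat.toNat_le_of_le_natCast (complexity_le_iff.2 ⟨p, hp, le_rfl⟩)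

theorem IsOptimalPrefixFree.exists_program {P : List Bool →. ℕ} (hP : IsOptimalPrefixFree P)
    (n : ℕ) : ∃ p : List Bool, n ∈ P p ∧ p.length = (complexity P n).toNat := by
  obtain ⟨p, hp, hl⟩ := exists_of_complexity_eq (ENat.natCast_toNat (hP.complexity_ne_top n)).symm
  exact ⟨p, hp, hl.antisymm (toNat_complexity_le hp)⟩

/-- Shortest programs of distinct numbers are distinct, so this is a subseries of the Kraft sum. -/
theorem IsOptimalPrefixFree.summable {P : List Bool →. ℕ} (hP : IsOptimalPrefixFree P) :
    Summable fun n => (1 / 2 : ℝ) ^ (complexity P n).toNat := by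
  choose p hp hl using hP.exists_program
  have hinj : Function.Injective p := fun a b hab =>
    Part.mem_unique (hp a) (hab ▸ hp b)
  refine (hP.2.1.summable.comp_injective hinj).congr fun n => ?_
  simp [Part.dom_iff_mem.2 ⟨n, hp n⟩, hl]

/-! ### A priori probability and prefix complexity -/

/-- The length of the `i`-th request in the enumeration `r`, provided that it asks for `k`. -/
def requestFor {α : Type*} (r : ℕ → Option (α × ℕ × ℕ)) (k i : ℕ) : Option ℕ :=
  (r i).bind fun x => if x.2.2 = k then some x.2.1 else none

theorem computable_requestFor {α : Type*} [Primcodable α] {r : ℕ → Option (α × ℕ × ℕ)}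
    (hr : Computable r) : Computable₂ (requestFor r) := by
  have h : Computable₂ fun (q : ℕ × ℕ) (x : α × ℕ × ℕ) =>
      if x.2.2 = q.1 then some x.2.1 else none := by
    have h2 : Primrec fun w : (ℕ × ℕ) × α × ℕ × ℕ => w.2.2 := Primrec.snd.comp Primrec.snd
    exact (Primrec.ite (Primrec.eq.comp (Primrec.snd.comp h2) (Primrec.fst.comp Primrec.fst))
      (Primrec.option_some.comp (Primrec.fst.comp h2)) (Primrec.const none)).to_comp.to₂
  exact (Computable.option_bind (hr.comp Computable.snd) h).to₂

theorem lowerSemicomputable_tsum_weight {ρ : ℕ → ℕ → Option ℕ} (hρ : Computable₂ ρ)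
    (hs : ∀ k, Summable fun i => weight (ρ k i)) :
    LowerSemicomputable fun k => ∑' i, weight (ρ k i) := by
  let A : ℕ → ℕ → ℕ × ℕ := fun k n => partialSum (ρ k) n
  have hA : Computable₂ A := computable_partialSum hρ
  let f : ℕ → ℕ → ℚ := fun k n => (A k n).1 / 2 ^ (A k n).2
  have hf : ∀ k n, (f k n : ℝ) = ∑ i ∈ Finset.range n, weight (ρ k i) := by
    intro k n
    rw [← dyadic_partialSum]
    simp [f, dyadic, A]
  -- `ComputableRat₂` adds 1 to the denominator, so 1 is subtracted here.
  refine ⟨f, ⟨fun k n => (A k n).1, fun _ _ => 0, fun k n => 2 ^ (A k n).2 - 1, ?_, ?_, ?_, ?_⟩,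
    ?_, ?_⟩
  · exact Computable.fst.comp hA
  · exact Computable.const 0
  · exact (Primrec.nat_sub.comp primrec_two_pow (Primrec.const 1)).to_comp.comp
      (Computable.snd.comp hA)
  · intro k n
    have : ((2 ^ (A k n).2 - 1 : ℕ) : ℚ) + 1 = 2 ^ (A k n).2 := by
      have h : 2 ^ (A k n).2 - 1 + 1 = 2 ^ (A k n).2 := Nat.sub_add_cancel Nat.one_le_two_pow
      exact_mod_cast h
    simp only [this, f]
    simp
  · intro k
    refine monotone_nat_of_le_succ fun n => ?_
    have : (f k n : ℝ) ≤ f k (n + 1) := by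
      rw [hf, hf, Finset.sum_range_succ]
      linarith [weight_nonneg (ρ k n)]
    exact_mod_cast this
  · intro k
    simp_rw [hf]
    exact (hs k).hasSum.tendsto_sum_nat

/-- The total weight of all programs of N is lower semicomputable in N and summable by Kraft's
inequality, so `m` dominates it, and with it each single program's weight. -/
theorem IsAprioriProbability.exists_pow_complexity_le {m : ℕ → ℝ} (hm : IsAprioriProbability m)
    {P : List Bool →. ℕ} (hP : Partrec P) (hPf : PrefixFree P) :
    ∃ C : ℝ, ∀ p N, N ∈ P p → (1 / 2) ^ p.length ≤ C * m N := by
  classical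
  let g : List Bool →. ℕ × ℕ := fun p => (P p).map fun N => (p.length, N)
  have hg : Partrec g := Partrec.map hP (Computable.pair
    (Computable.list_length.comp Computable.fst) Computable.snd).to₂
  have hgm : ∀ p l N, (l, N) ∈ g p ↔ N ∈ P p ∧ p.length = l := by
    intro p l N
    simp only [g, Part.mem_map_iff, Prod.mk.injEq]
    exact ⟨fun ⟨a, h1, h2, h3⟩ => ⟨h3 ▸ h1, h2⟩, fun ⟨h1, h2⟩ => ⟨N, h1, h2, rfl⟩⟩
  obtain ⟨r, hr, hr1, hr2, hr3⟩ := exists_enumeration hg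
  have hsum : Summable fun i => weight ((r i).map fun x => x.2.1) := by
    refine summable_of_sum_le (fun i => weight_nonneg _) fun s =>
      sum_weight_le_tsum hr3 hPf.summable (fun p => by split_ifs <;> positivity) ?_ s
    intro i p l N h
    obtain ⟨h1, rfl⟩ := (hgm p l N).1 (hr1 _ _ _ h)
    rw [if_pos (Part.dom_iff_mem.2 ⟨N, h1⟩)]
  have hrow : ∀ i, HasSum (fun k => weight (requestFor r k i))
      (weight ((r i).map fun x => x.2.1)) := by
    intro i
    cases h : r i with
    | none => simp [requestFor, h, hasSum_zero]
    | some x =>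
      have := hasSum_ite_eq x.2.2 ((1 / 2 : ℝ) ^ x.2.1)
      convert! this using 1
      funext k
      by_cases hk : x.2.2 = k
      · simp [requestFor, h, hk]
      · simp [requestFor, h, hk, Ne.symm hk]
  -- Each enumerated program feeds exactly one number, so the double series regroups the Kraft sum;
  -- nonnegativity allows the exchange of order.
  have hprod : Summable fun q : ℕ × ℕ => weight (requestFor r q.2 q.1) := by
    refine (summable_prod_of_nonneg fun q => weight_nonneg _).2 ⟨fun i => (hrow i).summable, ?_⟩
    simpa only [(hrow _).tsum_eq] using hsum
  have hprod' : Summable fun q : ℕ × ℕ => weight (requestFor r q.1 q.2) := hprod.prod_symm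
  have hcol : ∀ k, Summable fun i => weight (requestFor r k i) := fun k => hprod'.prod_factor k
  obtain ⟨C, hC⟩ := hm.2 (fun k => ∑' i, weight (requestFor r k i))
    ⟨fun k => tsum_nonneg fun i => weight_nonneg _, hprod'.prod,
      lowerSemicomputable_tsum_weight (computable_requestFor hr) hcol⟩
  refine ⟨C, fun p N hN => le_trans ?_ (hC N)⟩
  obtain ⟨i, hi⟩ := hr2 p (p.length, N) ((hgm _ _ _).2 ⟨hN, rfl⟩)
  have := (hcol N).le_tsum i fun j _ => weight_nonneg _
  simpa [requestFor, hi] using this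

/-- A number N beyond the modulus at n + c would have m(N) below 2^(-(n+c)), since m(N) is a term of
that tail; but a program of length at most n forces m(N) ≥ 2^(-(n+c)). -/
theorem IsAprioriProbability.exists_busyBeaver_le_tailBeaver {m : ℕ → ℝ}
    (hm : IsAprioriProbability m) {P : List Bool →. ℕ} (hP : Partrec P) (hPf : PrefixFree P) :
    ∃ c : ℕ, ∀ n : ℕ, busyBeaver P n ≤ (tailBeaver m (n + c) : WithBot ℕ) := by
  obtain ⟨C, hC⟩ := hm.exists_pow_complexity_le hP hPf
  obtain ⟨c, hc⟩ := pow_unbounded_of_one_lt C (one_lt_two (α := ℝ))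
  refine ⟨c, fun n => busyBeaver_le fun N p hp hl => ?_⟩
  rw [Nat.cast_withBot, Nat.cast_withBot, WithBot.coe_le_coe]
  by_contra! hlt
  have htail : ∑' k : ℕ, m (k + (tailBeaver m (n + c) + 1)) < (2 : ℝ) ^ (-((n + c : ℕ) : ℤ)) :=
    (tailBeaver_isLeast m (n + c)).1
  have hle : m N ≤ ∑' k : ℕ, m (k + (tailBeaver m (n + c) + 1)) := by
    have := ((summable_nat_add_iff (tailBeaver m (n + c) + 1)).2 hm.1.2.1).le_tsum
      (N - (tailBeaver m (n + c) + 1)) fun j _ => hm.1.1 _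
    rwa [Nat.sub_add_cancel (by omega)] at this
  have h1 : (1 / 2 : ℝ) ^ n ≤ 2 ^ c * m N :=
    calc (1 / 2 : ℝ) ^ n ≤ (1 / 2) ^ p.length :=
          pow_le_pow_of_le_one (by norm_num) (by norm_num) (by omega)
      _ ≤ C * m N := hC p N hp
      _ ≤ 2 ^ c * m N := mul_le_mul_of_nonneg_right hc.le (hm.1.1 N)
  have h2 := hle.trans_lt htail
  rw [zpow_neg, zpow_natCast, pow_add] at h2
  have h3 : (2 : ℝ) ^ c * m N < 2 ^ c * (2 ^ n * 2 ^ c)⁻¹ := by gcongr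
  have h4 : (2 : ℝ) ^ c * (2 ^ n * 2 ^ c)⁻¹ = (1 / 2) ^ n := by
    rw [one_div, inv_pow]; field_simp
  linarith

/-! ### The modulus of convergence and plain complexity -/

/-- Dyadic lower approximations of a nonnegative lower semicomputable sequence. -/
theorem LowerSemicomputable.exists_dyadic {m : ℕ → ℝ} (h : LowerSemicomputable m)
    (h0 : ∀ k, 0 ≤ m k) : ∃ a : ℕ → ℕ → ℕ, Computable₂ a ∧ (∀ k s, (a k s : ℝ) / 2 ^ s ≤ m k) ∧
      ∀ k, Filter.Tendsto (fun s => (a k s : ℝ) / 2 ^ s) Filter.atTop (nhds (m k)) := by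
  obtain ⟨f, ⟨a, b, d, ha, hb, hd, hf⟩, hmono, hlim⟩ := h
  -- The approximation is rounded down to a multiple of 2^(-s); truncated subtraction replaces
  -- negative values by 0, harmless because `m` is nonnegative.
  have hC : Computable₂ fun k s => 2 ^ s * (a k s - b k s) / (d k s + 1) := by
    have h1 : Computable fun q : ℕ × ℕ => 2 ^ q.2 * (a q.1 q.2 - b q.1 q.2) :=
      Primrec.nat_mul.to_comp.comp (primrec_two_pow.to_comp.comp Computable.snd)
        (Primrec.nat_sub.to_comp.comp ha hb)
    exact Primrec.nat_div.to_comp.comp h1 (Computable.succ.comp hd)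
  have hlow : ∀ k s, (f k s : ℝ) - (1 / 2) ^ s ≤
      ((2 ^ s * (a k s - b k s) / (d k s + 1) : ℕ) : ℝ) / 2 ^ s := by
    intro k s
    have h1 := Nat.lt_div_mul_add (a := 2 ^ s * (a k s - b k s)) (Nat.succ_pos (d k s))
    set v := 2 ^ s * (a k s - b k s) / (d k s + 1)
    have h2 : (2 : ℝ) ^ s * ((a k s - b k s : ℕ) : ℝ) ≤ (v + 1) * (d k s + 1) := by
      have : 2 ^ s * (a k s - b k s) ≤ (v + 1) * (d k s + 1) := by
        simp only [Nat.succ_eq_add_one] at h1; linarith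
      exact_mod_cast this
    have h3 : (a k s : ℝ) - b k s ≤ ((a k s - b k s : ℕ) : ℝ) := by
      have : a k s ≤ (a k s - b k s) + b k s := by omega
      have : (a k s : ℝ) ≤ ((a k s - b k s : ℕ) : ℝ) + b k s := by exact_mod_cast this
      linarith
    have h4 : (2 : ℝ) ^ s * (a k s - b k s) ≤ (v + 1) * (d k s + 1) :=
      (mul_le_mul_of_nonneg_left h3 (by positivity)).trans h2
    have h5 : (f k s : ℝ) ≤ (v + 1) / 2 ^ s := by
      rw [hf]
      push_cast
      rw [div_le_div_iff₀ (by positivity) (by positivity)]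
      linarith
    rw [one_div, inv_pow]
    rw [add_div, one_div] at h5
    linarith
  have hhigh : ∀ k s, ((2 ^ s * (a k s - b k s) / (d k s + 1) : ℕ) : ℝ) / 2 ^ s ≤ m k := by
    intro k s
    rcases le_total (a k s) (b k s) with hab | hab
    · simpa [Nat.sub_eq_zero_of_le hab] using h0 k
    · refine le_trans ?_ ((Rat.cast_mono.comp (hmono k)).ge_of_tendsto (hlim k) s)
      rw [div_le_iff₀ (by positivity)]
      refine Nat.cast_div_le.trans (le_of_eq ?_)
      simp only [Function.comp_apply, hf]
      push_cast [hab]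
      ring
  refine ⟨_, hC, hhigh, fun k => ?_⟩
  have h1 : Filter.Tendsto (fun s => (f k s : ℝ) - (1 / 2) ^ s) Filter.atTop (nhds (m k)) := by
    simpa using (hlim k).sub
      (tendsto_pow_atTop_nhds_zero_of_lt_one (r := (1 / 2 : ℝ)) (by norm_num) (by norm_num))
  exact tendsto_of_tendsto_of_tendsto_of_le_of_le h1 tendsto_const_nhds (hlow k)
    fun s => hhigh k s

theorem computable_sum_range {a : ℕ → ℕ → ℕ} (ha : Computable₂ a) :
    Computable₂ fun N s => ∑ k ∈ Finset.range N, a k s := by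
  have h : Computable₂ fun (q : ℕ × ℕ) (z : ℕ × ℕ) => z.2 + a z.1 q.2 := by
    have h1 : Computable fun w : (ℕ × ℕ) × ℕ × ℕ => a w.2.1 w.1.2 :=
      ha.comp (Computable.fst.comp Computable.snd) (Computable.snd.comp Computable.fst)
    exact (Primrec.nat_add.to_comp.comp (Computable.snd.comp Computable.snd) h1).to₂
  have h2 : ∀ q : ℕ × ℕ, Nat.rec (motive := fun _ => ℕ) 0 (fun k z => z + a k q.2) q.1 =
      ∑ k ∈ Finset.range q.1, a k q.2 := by
    rintro ⟨N, s⟩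
    induction N with
    | zero => rfl
    | succ N ih => rw [Finset.sum_range_succ, ← ih]
  exact (Computable.nat_rec Computable.fst (Computable.const 0) h).of_eq h2

/-- A word of length n + e + 1 carries both `n`, through its length, and an approximation of the
total sum. From these a search finds a point whose tail is small enough. -/
theorem IsOptimalPlain.exists_tailBeaver_le {D : List Bool →. ℕ} (hD : IsOptimalPlain D)
    {m : ℕ → ℝ} (hm : IsLowerSemicomputableSeries m) :
    ∃ c : ℕ, ∀ n : ℕ, (tailBeaver m n : WithBot ℕ) ≤ busyBeaver D (n + c) := by
  obtain ⟨h0, hs, hlow⟩ := hm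
  obtain ⟨a, ha, hle, hlim⟩ := hlow.exists_dyadic h0
  obtain ⟨e, he⟩ := pow_unbounded_of_one_lt (∑' k, m k) (one_lt_two (α := ℝ))
  -- `t` codes a cutoff N and a stage s. The term 2^s on the right encodes the target (q - 1) /
  -- 2^(n+1) without subtraction.
  let look : List Bool → ℕ → Option ℕ := fun p t =>
    if bitValue p * 2 ^ t.unpair.2 < 2 ^ (p.length - (e + 1) + 1) *
        (∑ k ∈ Finset.range (t.unpair.1 + 1), a k t.unpair.2) + 2 ^ t.unpair.2
      then some t.unpair.1 else none
  have hlook : Computable₂ look := by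
    have hN : Computable fun q : List Bool × ℕ => q.2.unpair.1 :=
      Computable.fst.comp (Computable.unpair.comp Computable.snd)
    have hS : Computable fun q : List Bool × ℕ => q.2.unpair.2 :=
      Computable.snd.comp (Computable.unpair.comp Computable.snd)
    have hS2 := primrec_two_pow.to_comp.comp hS
    have h1 : Computable fun q : List Bool × ℕ => bitValue q.1 * 2 ^ q.2.unpair.2 :=
      Primrec.nat_mul.to_comp.comp (primrec_bitValue.to_comp.comp Computable.fst) hS2
    have h2 : Computable fun q : List Bool × ℕ => 2 ^ (q.1.length - (e + 1) + 1) :=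
      primrec_two_pow.to_comp.comp (Computable.succ.comp (Primrec.nat_sub.to_comp.comp
        (Computable.list_length.comp Computable.fst) (Computable.const (e + 1))))
    have h3 : Computable fun q : List Bool × ℕ =>
        ∑ k ∈ Finset.range (q.2.unpair.1 + 1), a k q.2.unpair.2 :=
      (computable_sum_range ha).comp (Computable.succ.comp hN) hS
    have h4 : Computable fun q : List Bool × ℕ => 2 ^ (q.1.length - (e + 1) + 1) *
        (∑ k ∈ Finset.range (q.2.unpair.1 + 1), a k q.2.unpair.2) + 2 ^ q.2.unpair.2 :=
      Primrec.nat_add.to_comp.comp (Primrec.nat_mul.to_comp.comp h2 h3) hS2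
    have h5 : Computable fun q : List Bool × ℕ => bif decide (bitValue q.1 * 2 ^ q.2.unpair.2 <
        2 ^ (q.1.length - (e + 1) + 1) * (∑ k ∈ Finset.range (q.2.unpair.1 + 1), a k q.2.unpair.2) +
          2 ^ q.2.unpair.2) then some q.2.unpair.1 else none :=
      Computable.cond (Primrec.nat_lt.decide.to_comp.comp h1 h4)
        (Computable.option_some.comp hN) (Computable.const none)
    exact h5.of_eq fun q => by simp only [look, Bool.cond_decide]
  let M : List Bool →. ℕ := fun p => Nat.rfindOpt (look p)
  obtain ⟨c, hc⟩ := hD.2 M (Partrec.rfindOpt hlook)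
  refine ⟨e + 1 + c, fun n => ?_⟩
  set S := ∑' k, m k with hS
  have hS0 : 0 ≤ S := tsum_nonneg h0
  let q := ⌊S * 2 ^ (n + 1)⌋₊
  have hq1 : (q : ℝ) ≤ S * 2 ^ (n + 1) := Nat.floor_le (by positivity)
  have hq2 : S * 2 ^ (n + 1) < q + 1 := Nat.lt_floor_add_one _
  have hqlt : q < 2 ^ (n + (e + 1)) := by
    have : (q : ℝ) < 2 ^ (n + (e + 1)) := by
      refine hq1.trans_lt ?_
      rw [show n + (e + 1) = e + (n + 1) by ring, pow_add _ e]
      gcongr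
    exact_mod_cast this
  obtain ⟨p, hpl, hpv⟩ := exists_bitValue_eq _ _ hqlt
  have hpn : p.length - (e + 1) + 1 = n + 1 := by omega
  have look_iff : ∀ t N, look p t = some N ↔ N = t.unpair.1 ∧ ((q : ℝ) - 1) / 2 ^ (n + 1) <
      ∑ k ∈ Finset.range (t.unpair.1 + 1), (a k t.unpair.2 : ℝ) / 2 ^ t.unpair.2 := by
    intro t N
    simp only [look, hpv, hpn]
    rw [← Finset.sum_div, div_lt_div_iff₀ (by positivity) (by positivity)]
    have : q * 2 ^ t.unpair.2 < 2 ^ (n + 1) * (∑ k ∈ Finset.range (t.unpair.1 + 1), a k t.unpair.2)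
        + 2 ^ t.unpair.2 ↔ ((q : ℝ) - 1) * 2 ^ t.unpair.2 <
          (∑ k ∈ Finset.range (t.unpair.1 + 1), (a k t.unpair.2 : ℝ)) * 2 ^ (n + 1) := by
      rw [← @Nat.cast_lt ℝ]
      push_cast
      constructor <;> intro h <;> linarith
    rw [← this]
    split_ifs with h
    · simp [h, eq_comm]
    · simp [h]
  have hdom : (M p).Dom := by
    -- Aiming at q - 1 instead of q keeps the target strictly below the sum, so the search halts
    -- even if q / 2^(n+1) equals it.
    have hlt : ((q : ℝ) - 1) / 2 ^ (n + 1) < S := by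
      rw [div_lt_iff₀ (by positivity)]; linarith
    have h1 := (hs.hasSum.tendsto_sum_nat.comp (Filter.tendsto_add_atTop_nat 1)).eventually
      (lt_mem_nhds hlt)
    obtain ⟨N, hN⟩ := h1.exists
    have h2 := (tendsto_finsetSum (Finset.range (N + 1)) fun k _ => hlim k).eventually
      (lt_mem_nhds hN)
    obtain ⟨s, hs'⟩ := h2.exists
    refine Nat.rfindOpt_dom.2 ⟨Nat.pair N s, N, (look_iff _ _).2 ?_⟩
    simpa using hs'
  obtain ⟨N, hN⟩ := Part.dom_iff_mem.1 hdom
  obtain ⟨t, ht⟩ := Nat.rfindOpt_spec hN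
  obtain ⟨rfl, hlt⟩ := (look_iff _ _).1 ht
  have htail : ∑' k : ℕ, m (k + (t.unpair.1 + 1)) < (2 : ℝ) ^ (-(n : ℤ)) := by
    have h1 := hs.sum_add_tsum_nat_add (t.unpair.1 + 1)
    have h2 := hlt.trans_le (Finset.sum_le_sum fun k _ => hle k t.unpair.2)
    have h3 : S < ((q : ℝ) + 1) / 2 ^ (n + 1) := by rwa [lt_div_iff₀ (by positivity)]
    -- The total and the partial sum found are both confined to a window of two grid steps; this is
    -- why the precision is n + 1.
    have h4 : ((q : ℝ) + 1) / 2 ^ (n + 1) - (q - 1) / 2 ^ (n + 1) = (2 : ℝ) ^ (-(n : ℤ)) := by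
      rw [zpow_neg, zpow_natCast, pow_succ]; field_simp; ring
    linarith
  have hcompl : complexity D t.unpair.1 ≤ (n + (e + 1 + c) : ℕ) :=
    calc complexity D t.unpair.1 ≤ complexity M t.unpair.1 + c := hc _
      _ ≤ ((n + (e + 1) : ℕ) : ℕ∞) + c := by
          gcongr
          exact complexity_le_iff.2 ⟨p, hN, hpl.le⟩
      _ = (n + (e + 1 + c) : ℕ) := by push_cast; ring
  exact (WithBot.coe_le_coe.2 ((tailBeaver_isLeast m n).2 htail)).trans
    (le_busyBeaver hcompl (by push_cast; rfl))

/-! ### Comparison of the busy beaver functions -/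

theorem IsOptimalPrefixFree.exists_busyBeaver_le_add_complexity {D P : List Bool →. ℕ}
    (hD : Partrec D) (hP : IsOptimalPrefixFree P) :
    ∃ c : ℕ, ∀ n : ℕ, busyBeaver D n ≤ busyBeaver P (n + (complexity P n).toNat + c) := by
  have hx : REPred fun q : ℕ × ℕ => q.2 ≤ q.1 :=
    (ComputablePred.computable_iff.2 ⟨_, (Primrec.nat_le.comp Primrec.snd
      Primrec.fst).decide.to_comp, by simp⟩).to_re
  have hy : REPred fun q : ℕ × ℕ => q.1 + (complexity P q.1).toNat ≤ q.2 := by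
    have hR : Computable₂ fun (q : ℕ × ℕ) (l : ℕ) => decide (q.1 + l ≤ q.2) :=
      (Primrec.nat_le.comp (Primrec.nat_add.comp (Primrec.fst.comp Primrec.fst) Primrec.snd)
        (Primrec.snd.comp Primrec.fst)).decide.to_comp.to₂
    refine (rePred_exists_program hP.1 hR).of_eq fun q => ?_
    simp only [decide_eq_true_eq]
    constructor
    · rintro ⟨p, hp, h⟩
      have := toNat_complexity_le hp
      omega
    · intro h
      obtain ⟨p, hp, hl⟩ := hP.exists_program q.1
      exact ⟨p, hp, by omega⟩
  obtain ⟨⟨c, hc⟩, -⟩ := hP.exists_busyBeaver_le hD (x := fun n => n)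
    (y := fun n => n + (complexity P n).toNat) (fun n => by simp) hx hy (by simpa using hP.summable)
  exact ⟨c, fun n => by simpa using hc n⟩

theorem IsOptimalPrefixFree.exists_busyBeaver_sub_complexity_le {D P : List Bool →. ℕ}
    (hD : Partrec D) (hP : IsOptimalPrefixFree P) :
    ∃ c : ℕ, ∀ n : ℕ, busyBeaver D (n - (complexity P n).toNat - c) ≤ busyBeaver P n := by
  have hx : REPred fun q : ℕ × ℕ => q.2 ≤ q.1 - (complexity P q.1).toNat := by
    have hR : Computable₂ fun (q : ℕ × ℕ) (l : ℕ) => decide (q.2 ≤ q.1 - l) :=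
      (Primrec.nat_le.comp (Primrec.snd.comp Primrec.fst)
        (Primrec.nat_sub.comp (Primrec.fst.comp Primrec.fst) Primrec.snd)).decide.to_comp.to₂
    refine (rePred_exists_program hP.1 hR).of_eq fun q => ?_
    simp only [decide_eq_true_eq]
    constructor
    · rintro ⟨p, hp, h⟩
      have := toNat_complexity_le hp
      omega
    · intro h
      obtain ⟨p, hp, hl⟩ := hP.exists_program q.1
      exact ⟨p, hp, by omega⟩
  have hy : REPred fun q : ℕ × ℕ => q.1 ≤ q.2 :=
    (ComputablePred.computable_iff.2 ⟨_, (Primrec.nat_le.comp Primrec.fst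
      Primrec.snd).decide.to_comp, by simp⟩).to_re
  -- The exponent is min(n, K(n)), so each term is at most 2^(-K(n)) + 2^(-n).
  have hs : Summable fun n => (1 / 2 : ℝ) ^ (n - (n - (complexity P n).toNat)) := by
    refine Summable.of_nonneg_of_le (fun n => by positivity) (fun n => ?_) (hP.summable.add
      (summable_geometric_of_lt_one (r := (1 / 2 : ℝ)) (by norm_num) (by norm_num)))
    rcases le_total n (complexity P n).toNat with h | h
    · rw [Nat.sub_eq_zero_of_le h, Nat.sub_zero]
      linarith [show (0 : ℝ) ≤ (1 / 2) ^ (complexity P n).toNat by positivity]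
    · rw [Nat.sub_sub_self h]
      linarith [show (0 : ℝ) ≤ (1 / 2) ^ n by positivity]
  obtain ⟨-, c, hc⟩ := hP.exists_busyBeaver_le hD (x := fun n => n - (complexity P n).toNat)
    (y := fun n => n) (fun n => Nat.sub_le _ _) hx hy hs
  -- Truncation only enlarges the argument, so monotonicity passes to the integer difference.
  exact ⟨c, fun n => (busyBeaver_mono D (by omega)).trans (hc n)⟩

end BusyBeaver

open BusyBeaver in
theorem theorem1
    (D : List Bool →. ℕ) (hD : IsOptimalPlain D)
    (P : List Bool →. ℕ) (hP : IsOptimalPrefixFree P)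
    (m : ℕ → ℝ) (hm : IsAprioriProbability m) :
    -- (i)
    (∃ c : ℕ, ∀ n : ℕ,
      busyBeaver P n ≤ (tailBeaver m (n + c) : WithBot ℕ) ∧
      (tailBeaver m n : WithBot ℕ) ≤ busyBeaver D (n + c)) ∧
    -- (ii)
    (∃ c : ℕ, ∀ n : ℕ,
      busyBeaver D n ≤ busyBeaver P (n + (complexity P n).toNat + c)) ∧
    -- (iii)
    (∀ x y : ℕ → ℕ, (∀ n, x n ≤ y n) →
      LowerSemicomputable (fun n => (x n : ℝ)) →
      UpperSemicomputable (fun n => (y n : ℝ)) →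
      Summable (fun n => (2 : ℝ) ^ ((x n : ℤ) - (y n : ℤ))) →
      ∃ c : ℕ, ∀ n : ℕ, busyBeaver D (x n) ≤ busyBeaver P (y n + c)) ∧
    -- (ii')
    (∃ c : ℕ, ∀ n : ℕ,
      busyBeaver D (n - (complexity P n).toNat - c) ≤ busyBeaver P n) ∧
    -- (iii')
    (∀ x y : ℕ → ℕ, (∀ n, x n ≤ y n) →
      LowerSemicomputable (fun n => (x n : ℝ)) →
      UpperSemicomputable (fun n => (y n : ℝ)) →
      Summable (fun n => (2 : ℝ) ^ ((x n : ℤ) - (y n : ℤ))) →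
      ∃ c : ℕ, ∀ n : ℕ, busyBeaver D (x n - c) ≤ busyBeaver P (y n)) := by
  obtain ⟨c₁, hc₁⟩ := hm.exists_busyBeaver_le_tailBeaver hP.1 hP.2.1
  obtain ⟨c₂, hc₂⟩ := hD.exists_tailBeaver_le hm.1
  have key : ∀ x y : ℕ → ℕ, (∀ n, x n ≤ y n) →
      LowerSemicomputable (fun n => (x n : ℝ)) →
      UpperSemicomputable (fun n => (y n : ℝ)) →
      Summable (fun n => (2 : ℝ) ^ ((x n : ℤ) - (y n : ℤ))) →
      (∃ c : ℕ, ∀ n : ℕ, busyBeaver D (x n) ≤ busyBeaver P (y n + c)) ∧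
        ∃ c : ℕ, ∀ n : ℕ, busyBeaver D (x n - c) ≤ busyBeaver P (y n) := by
    intro x y hxy hx hy hs
    refine hP.exists_busyBeaver_le hD.1 hxy hx.rePred hy.rePred (hs.congr fun n => ?_)
    rw [one_div, inv_pow, ← zpow_natCast, ← zpow_neg, Nat.cast_sub (hxy n), neg_sub]
  -- One constant serves both inequalities: the first is applied at n + c₂, so monotonicity is
  -- needed only for the busy beaver functions.
  refine ⟨⟨c₁ + c₂, fun n => ⟨(busyBeaver_mono P ?_).trans ((hc₁ (n + c₂)).trans_eq ?_),
      (hc₂ n).trans (busyBeaver_mono D ?_)⟩⟩,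
    hP.exists_busyBeaver_le_add_complexity hD.1, fun x y h1 h2 h3 h4 => (key x y h1 h2 h3 h4).1,
    hP.exists_busyBeaver_sub_complexity_le hD.1, fun x y h1 h2 h3 h4 => (key x y h1 h2 h3 h4).2⟩
  · push_cast; omega
  · congr 2; ring
  · push_cast; omega
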